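/- All logarithms are to base $2$. Let $h(p)=-p\log p-(1-p)\log(1-p)$, let $h^{-1}:[0,1]\to[0,1/2]$ be the inverse of $h$ restricted to $[0,1/2]$, and for $t\in[0,1]$ let $\eta_t=(1-2h^{-1}(1-t))^2$. For a random vector $X^n$ on $\{0,1\}^n$ and $t\in[0,1]$, let $I_{\mathrm{BSC}}^{(t)}(X^n;Y^n)$, respectively $I_{\mathrm{BEC}}^{(t)}(X^n;Y^n)$, denote the mutual information between $X^n$ and the output $Y^n$ of a memoryless binary symmetric channel (crossover probability $h^{-1}(1-t)$), respectively binary erasure channel (erasure probability $1-t$), of capacity $t$. The rate of a code $C\subset\{0,1\}^n$ is $R=\frac1n\log|C|$. For $\varepsilon\ge 0$, a code $C\subset\{0,1\}^n$ of rate $R$ is $\varepsilon$-information-capacity achieving for the BEC if, for every $t\in(R,1]$, $I_{\mathrm{BEC}}^{(t)}(X^n;Y^n)\ge n(R-\varepsilon)$, where $X^n\sim\mathrm{Uniform}(C)$. Theorem. Let $\varepsilon\ge 0$ and let $C\subset\{0,1\}^n$ be a linear code of rate $R>0$ that is $\varepsilon$-information-capacity achieving for the BEC, and let $X^n\sim\mathrm{Uniform}(C)$.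 Then for every $t\in[0,1]$, $$I_{\mathrm{BSC}}^{(t)}(X^n;Y^n)\ \ge\ n\left(1-\frac{\varepsilon}{R}\right)\cdot\begin{cases} t, & t<1-h\left(\frac{1-\sqrt R}{2}\right),\\[1ex] \dfrac{tR}{\eta_t}, & t\ge 1-h\left(\frac{1-\sqrt R}{2}\right).\end{cases}$$ -/

import Mathlib

namespace BinaryChannels

noncomputable section

open scoped BigOperators

/-- The binary entropy function `h`, in bits. -/
def h (p : ℝ) : ℝ := -p * Real.logb 2 p - (1 - p) * Real.logb 2 (1 - p)

/-- The inverse of `h` restricted to `[0, 1/2]`. -/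
def hInv (y : ℝ) : ℝ := Function.invFunOn h (Set.Icc 0 (1 / 2)) y

/-- The strong data processing coefficient `η_t` of the binary symmetric channel of
capacity `t`. -/
def eta (t : ℝ) : ℝ := (1 - 2 * hInv (1 - t)) ^ 2

/-- Mutual information, in bits, of a pair of random variables with finite alphabets and joint
probability mass function `Q`. (Terms with `Q x y = 0` contribute `0`.) -/
def mutualInfo {α β : Type} [Fintype α] [Fintype β] (Q : α → β → ℝ) : ℝ :=
  ∑ x, ∑ y, Q x y * Real.logb 2 (Q x y / ((∑ y', Q x y') * (∑ x', Q x' y)))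

/-- Joint probability mass function of the input, distributed according to `P`, and the output of
the channel with transition probabilities `W x y = Pr(Y = y | X = x)`. -/
def joint {α β : Type} (P : α → ℝ) (W : α → β → ℝ) : α → β → ℝ := fun x y => P x * W x y

/-- The capacity of a channel with finite alphabets: the supremum over all input distributions of
the mutual information between input and output. -/
def capacity {α β : Type} [Fintype α] [Fintype β] (W : α → β → ℝ) : ℝ :=
  sSup {I : ℝ | ∃ P : α → ℝ, (∀ x, 0 ≤ P x) ∧ ∑ x, P x = 1 ∧ I = mutualInfo (joint P W)}

/-- `n` independent uses of the channel `W`. -/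
def memoryless {α β : Type} (n : ℕ) (W : α → β → ℝ) : (Fin n → α) → (Fin n → β) → ℝ :=
  fun x y => ∏ i, W (x i) (y i)

/-- The binary symmetric channel of capacity `t`, for `t ∈ [0, 1]`: the input bit is flipped with
probability `h⁻¹(1 - t)`. -/
def bsc (t : ℝ) (x y : ZMod 2) : ℝ := if y = x then 1 - hInv (1 - t) else hInv (1 - t)

/-- The binary erasure channel of capacity `t`, for `t ∈ [0, 1]`: the input bit is received with
probability `t` and is erased (output `none`) with probability `1 - t`. -/
def bec (t : ℝ) (x : ZMod 2) : Option (ZMod 2) → ℝ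
  | none => 1 - t
  | some y => if y = x then t else 0

/-- Mutual information between an input vector with distribution `P` and the output of the
memoryless binary symmetric channel of capacity `t`. -/
def infoBSC {n : ℕ} (t : ℝ) (P : (Fin n → ZMod 2) → ℝ) : ℝ :=
  mutualInfo (joint P (memoryless n (bsc t)))

/-- Mutual information between an input vector with distribution `P` and the output of the
memoryless binary erasure channel of capacity `t`. -/
def infoBEC {n : ℕ} (t : ℝ) (P : (Fin n → ZMod 2) → ℝ) : ℝ :=
  mutualInfo (joint P (memoryless n (bec t)))

/-- The probability mass function of the uniform distribution on the code `C`. -/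
def uniformOn {n : ℕ} (C : Set (Fin n → ZMod 2)) : (Fin n → ZMod 2) → ℝ :=
  C.indicator fun _ => (C.ncard : ℝ)⁻¹

/-- The rate `(log₂ |C|) / n` of a code of length `n`. -/
def rate {n : ℕ} (C : Set (Fin n → ZMod 2)) : ℝ := Real.logb 2 C.ncard / n

/-- A code `C` of rate `R` is `ε`-information-capacity achieving for the BEC if, for `X` uniform
on `C`, `I_BEC^{(t)}(X;Y) ≥ n (R - ε)` for every capacity `t > R`. -/
def IsInfoCapacityAchievingBEC {n : ℕ} (C : Set (Fin n → ZMod 2)) (ε : ℝ) : Prop :=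
  ∀ t : ℝ, rate C < t → t ≤ 1 → (n : ℝ) * (rate C - ε) ≤ infoBEC t (uniformOn C)

/-- `h⁻¹` is indeed the inverse of `h` on `[0, 1/2]`. -/
theorem hInv_spec {y : ℝ} (hy : y ∈ Set.Icc (0 : ℝ) 1) :
    hInv y ∈ Set.Icc (0 : ℝ) (1 / 2) ∧ h (hInv y) = y := by
  have hh : h = fun p => Real.binEntropy p / Real.log 2 := by
    funext p
    simp only [h, Real.binEntropy_eq_negMulLog_add_negMulLog_one_sub, Real.negMulLog, Real.logb]
    ring
  have hl : Real.log 2 ≠ 0 := (Real.log_pos one_lt_two).ne'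
  have hc : ContinuousOn h (Set.Icc 0 (1 / 2)) := by
    rw [hh]; exact (Real.binEntropy_continuous.div_const _).continuousOn
  have h0 : h 0 = 0 := by simp [h]
  have h1 : h (1 / 2) = 1 := by
    rw [hh]
    have := Real.binEntropy_two_inv
    simp only [one_div, this]
    exact div_self hl
  have hex : ∃ p ∈ Set.Icc (0 : ℝ) (1 / 2), h p = y := by
    have := intermediate_value_Icc (by norm_num : (0 : ℝ) ≤ 1 / 2) hc
    rw [h0, h1] at this
    exact this hy
  exact ⟨Function.invFunOn_mem hex, Function.invFunOn_eq hex⟩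

theorem mutualInfo_joint {α β : Type} [Fintype α] [Fintype β] (P : α → ℝ) (W : α → β → ℝ)
    (hP : ∀ x, 0 ≤ P x) (hW : ∀ x y, 0 ≤ W x y) (hW1 : ∀ x, ∑ y, W x y = 1) :
    mutualInfo (joint P W) = (∑ y, -((∑ x, P x * W x y) * Real.logb 2 (∑ x, P x * W x y)))
      + ∑ x, P x * ∑ y, W x y * Real.logb 2 (W x y) := by
  have key : ∀ x y, joint P W x y * Real.logb 2 (joint P W x y /
      ((∑ y', joint P W x y') * (∑ x', joint P W x' y))) =
      P x * (W x y * Real.logb 2 (W x y))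
        - P x * W x y * Real.logb 2 (∑ x', P x' * W x' y) := by
    intro x y
    simp only [joint, ← Finset.mul_sum, hW1, mul_one]
    rcases eq_or_ne (P x) 0 with h0 | h0
    · simp [h0]
    rcases eq_or_ne (W x y) 0 with h1 | h1
    · simp [h1]
    have hpos : 0 < P x * W x y :=
      mul_pos (lt_of_le_of_ne (hP x) h0.symm) (lt_of_le_of_ne (hW x y) h1.symm)
    have hs : 0 < ∑ x', P x' * W x' y := lt_of_lt_of_le hpos
      (Finset.single_le_sum (f := fun x' => P x' * W x' y)
        (fun i _ => mul_nonneg (hP i) (hW i y)) (Finset.mem_univ x))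
    rw [mul_div_mul_left _ _ h0, Real.logb_div h1 hs.ne']
    ring
  unfold mutualInfo
  simp_rw [key, Finset.sum_sub_distrib, ← Finset.mul_sum, Finset.sum_neg_distrib]
  rw [Finset.sum_comm (f := fun x y => P x * W x y * Real.logb 2 (∑ x', P x' * W x' y))]
  simp_rw [← Finset.sum_mul]
  ring

theorem h_half : h (1 / 2) = 1 := by
  have : Real.logb 2 (1 / 2) = -1 := by
    rw [one_div, Real.logb_inv, Real.logb_self_eq_one one_lt_two]
  rw [h, show (1 : ℝ) - 1 / 2 = 1 / 2 by norm_num, this]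
  norm_num

theorem h_le_one (p : ℝ) : h p ≤ 1 := by
  have hl : 0 < Real.log 2 := Real.log_pos one_lt_two
  have hh : h p = Real.binEntropy p / Real.log 2 := by
    simp only [h, Real.binEntropy_eq_negMulLog_add_negMulLog_one_sub, Real.negMulLog, Real.logb]
    ring
  rw [hh, div_le_one hl]
  exact Real.binEntropy_le_log_two

theorem sum_zmod_two (f : ZMod 2 → ℝ) : ∑ x, f x = f 0 + f 1 := Fin.sum_univ_two f

/-- The channel `bsc t` does have capacity `t`. -/
theorem capacity_bsc {t : ℝ} (ht : t ∈ Set.Icc (0 : ℝ) 1) : capacity (bsc t) = t := by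
  obtain ⟨⟨hp0, hp1⟩, hp⟩ := hInv_spec (y := 1 - t) ⟨by linarith [ht.2], by linarith [ht.1]⟩
  have h10 : (1 : ZMod 2) ≠ 0 := by decide
  have h01 : (0 : ZMod 2) ≠ 1 := by decide
  have hI : ∀ P : ZMod 2 → ℝ, (∀ x, 0 ≤ P x) → ∑ x, P x = 1 → mutualInfo (joint P (bsc t)) =
      h (P 0 * hInv (1 - t) + P 1 * (1 - hInv (1 - t))) - (1 - t) := by
    intro P hP hP1
    rw [mutualInfo_joint P _ hP]
    · simp only [sum_zmod_two] at hP1 ⊢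
      have e : 1 - (P 0 * hInv (1 - t) + P 1 * (1 - hInv (1 - t))) =
        P 0 * (1 - hInv (1 - t)) + P 1 * hInv (1 - t) := by linear_combination (-1) * hP1
      simp only [bsc, h10, h01, if_true, if_false]
      rw [h] at hp
      generalize hInv (1 - t) = p at *
      rw [h, e, ← hp]
      linear_combination (p * Real.logb 2 p + (1 - p) * Real.logb 2 (1 - p)) * hP1
    · intro x y
      unfold bsc
      split_ifs <;> linarith
    · intro x
      rw [sum_zmod_two]
      have hx : x = 0 ∨ x = 1 := by revert x; decide
      rcases hx with rfl | rfl <;> simp [bsc]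
  refine IsGreatest.csSup_eq ⟨⟨fun _ => 1 / 2, fun _ => by norm_num, ?_, ?_⟩, ?_⟩
  · rw [sum_zmod_two]; norm_num
  · rw [hI _ (fun _ => by norm_num) (by rw [sum_zmod_two]; norm_num)]
    rw [← mul_add, show hInv (1 - t) + (1 - hInv (1 - t)) = 1 by ring, mul_one, h_half]
    ring
  · rintro I ⟨P, hP, hP1, rfl⟩
    rw [hI P hP hP1]
    linarith [h_le_one (P 0 * hInv (1 - t) + P 1 * (1 - hInv (1 - t)))]

/-- The channel `bec t` does have capacity `t`. -/
theorem capacity_bec {t : ℝ} (ht : t ∈ Set.Icc (0 : ℝ) 1) : capacity (bec t) = t := by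
  have h10 : (1 : ZMod 2) ≠ 0 := by decide
  have h01 : (0 : ZMod 2) ≠ 1 := by decide
  have hI : ∀ P : ZMod 2 → ℝ, (∀ x, 0 ≤ P x) → ∑ x, P x = 1 →
      mutualInfo (joint P (bec t)) = t * h (P 0) := by
    intro P hP hP1
    rw [mutualInfo_joint P _ hP]
    · simp only [sum_zmod_two, Fintype.sum_option] at hP1 ⊢
      have e : 1 - P 0 = P 1 := by linear_combination (-1) * hP1
      have hm : ∀ a : ℝ, a * t * Real.logb 2 (a * t) =
          t * (a * Real.logb 2 a) + a * (t * Real.logb 2 t) := by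
        intro a
        rcases eq_or_ne a 0 with h0 | h0
        · simp [h0]
        rcases eq_or_ne t 0 with h1 | h1
        · simp [h1]
        rw [Real.logb_mul h0 h1]; ring
      simp only [bec, h10, h01, if_true, if_false, mul_zero, zero_mul, add_zero, zero_add, hm]
      rw [← add_mul, hP1, one_mul, h, e]
      linear_combination ((1 - t) * Real.logb 2 (1 - t)) * hP1
    · intro x y
      rcases y with _ | y
      · simp only [bec]; linarith [ht.2]
      · simp only [bec]
        split_ifs
        · exact ht.1
        · exact le_rfl
    · intro x
      simp [Fintype.sum_option, bec]
  refine IsGreatest.csSup_eq ⟨⟨fun _ => 1 / 2, fun _ => by norm_num, ?_, ?_⟩, ?_⟩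
  · rw [sum_zmod_two]; norm_num
  · rw [hI _ (fun _ => by norm_num) (by rw [sum_zmod_two]; norm_num)]
    rw [h_half, mul_one]
  · rintro I ⟨P, hP, hP1, rfl⟩
    rw [hI P hP hP1]
    nlinarith [h_le_one (P 0), ht.1]

end

end BinaryChannels

namespace BinaryChannels

noncomputable section

/-! Expand the output entropy by the chain rule, each output being conditioned on the later ones.
Let `a` be the posterior mean of the sign of the current code bit. Over the BSC the current output
has conditional entropy `h ((1 + (1 - 2 * p) * a) / 2)`, at least the parabola `1 - t * a ^ 2`
(`one_sub_sq_mul_le_h`). Hence the BSC information is at least `t` times the `posteriorVariance` of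
`bsc t`. Over the BEC, linearity leaves each bit known or unbiased (`fiberLaw_bec_eq`), so `a` is 0
or ±1. There entropy and parabola agree, and the BEC information is exactly `t` times the
`posteriorVariance` of `bec t`.

Second moments compare the two channels: one use of `bsc t` preserves no more than one use of `bec
(eta t)`, and this tensorizes (`ChiSqLE.chiSq_le`). Therefore the BSC information at `t` is at least
`t` times the posterior variance for `bec (eta t)`. If `eta t > R`, that variance is the BEC
information at `eta t` divided by `eta t`, to which the hypothesis applies. If `eta t ≤ R`, the
variance only grows as the erasure channel worsens, so the bound at capacities just above `R`
carries over. The case split in the theorem is `eta t < R`. -/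

theorem h_eq_binEntropy (p : ℝ) : h p = Real.binEntropy p / Real.log 2 := by
  simp only [h, Real.binEntropy_eq_negMulLog_add_negMulLog_one_sub, Real.negMulLog, Real.logb]
  ring

theorem h_strictMonoOn : StrictMonoOn h (Set.Icc 0 (1 / 2)) := by
  intro a ha b hb hab
  rw [h_eq_binEntropy, h_eq_binEntropy]
  refine div_lt_div_of_pos_right (Real.binEntropy_strictMonoOn ?_ ?_ hab) (Real.log_pos one_lt_two)
  · simpa [one_div] using ha
  · simpa [one_div] using hb

/-! ### Binary entropy against a parabola. -/

/-- The deficit of the binary entropy (in nats) at bias `u`. -/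
def entropyDeficit (u : ℝ) : ℝ := Real.log 2 - Real.binEntropy ((1 + u) / 2)

theorem entropyDeficit_zero : entropyDeficit 0 = 0 := by
  simp [entropyDeficit]

theorem entropyDeficit_neg (u : ℝ) : entropyDeficit (-u) = entropyDeficit u := by
  rw [entropyDeficit, entropyDeficit, ← Real.binEntropy_one_sub]
  ring_nf

theorem hasDerivAt_entropyDeficit {u : ℝ} (h0 : -1 < u) (h1 : u < 1) :
    HasDerivAt entropyDeficit ((Real.log (1 + u) - Real.log (1 - u)) / 2) u := by
  have h2 : HasDerivAt (fun u : ℝ => (1 + u) / 2) (1 / 2) u :=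
    ((hasDerivAt_id u).const_add 1).div_const 2
  have h3 := (Real.hasDerivAt_binEntropy (p := (1 + u) / 2) (by linarith) (by linarith)).comp u h2
  have h4 := h3.const_sub (Real.log 2)
  refine h4.congr_deriv ?_
  rw [show 1 - (1 + u) / 2 = (1 - u) / 2 by ring, Real.log_div (by linarith) (by norm_num),
    Real.log_div (by linarith) (by norm_num)]
  ring

theorem continuous_entropyDeficit : Continuous entropyDeficit := by
  unfold entropyDeficit
  have := Real.binEntropy_continuous
  fun_prop

/-- The difference of the two sides vanishes at 0 and has derivative `2 * x ^ 2 / (1 - x ^ 2) ^ 2`.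
-/
theorem log_one_add_sub_log_one_sub_le {u : ℝ} (h0 : 0 ≤ u) (h1 : u < 1) :
    (Real.log (1 + u) - Real.log (1 - u)) / 2 ≤ u / (1 - u ^ 2) := by
  have hd : ∀ x ∈ Set.Ico (0 : ℝ) 1, HasDerivAt
      (fun x : ℝ => x / (1 - x ^ 2) - (Real.log (1 + x) - Real.log (1 - x)) / 2)
      (2 * x ^ 2 / (1 - x ^ 2) ^ 2) x := by
    rintro x ⟨hx0, hx1⟩
    have e : 1 - x ^ 2 ≠ 0 := by nlinarith
    have e1 : 1 + x ≠ 0 := by linarith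
    have e2 : 1 - x ≠ 0 := by linarith
    have a1 := ((hasDerivAt_id x).const_add 1).log e1
    have a2 := ((hasDerivAt_id x).const_sub 1).log e2
    have a3 := (hasDerivAt_id x).div (((hasDerivAt_id x).pow 2).const_sub 1) e
    refine (a3.sub ((a1.sub a2).div_const 2)).congr_deriv ?_
    have e3 : 1 - x ^ 2 = (1 - x) * (1 + x) := by ring
    simp only [id, Pi.pow_apply]
    rw [e3]
    field_simp
    ring
  have hm : MonotoneOn (fun x : ℝ => x / (1 - x ^ 2) - (Real.log (1 + x) - Real.log (1 - x)) / 2)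
      (Set.Ico 0 1) := by
    refine monotoneOn_of_deriv_nonneg (convex_Ico 0 1)
      (fun x hx => (hd x hx).continuousAt.continuousWithinAt) ?_ ?_
    · intro x hx
      exact (hd x (interior_subset hx)).differentiableAt.differentiableWithinAt
    · intro x hx
      rw [(hd x (interior_subset hx)).deriv]
      positivity
  have := hm ⟨le_rfl, one_pos⟩ ⟨h0, h1⟩ h0
  simp at this
  linarith

/-- With `D` the deficit, `u * D' - 2 * D` vanishes at 0 and has derivative `u * D'' - D'`, which
the preceding inequality makes nonnegative. -/
theorem two_mul_entropyDeficit_le {u : ℝ} (h0 : 0 ≤ u) (h1 : u < 1) :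
    2 * entropyDeficit u ≤ u * ((Real.log (1 + u) - Real.log (1 - u)) / 2) := by
  have hd : ∀ x ∈ Set.Ico (0 : ℝ) 1, HasDerivAt
      (fun x : ℝ => x * ((Real.log (1 + x) - Real.log (1 - x)) / 2) - 2 * entropyDeficit x)
      (x / (1 - x ^ 2) - (Real.log (1 + x) - Real.log (1 - x)) / 2) x := by
    rintro x ⟨hx0, hx1⟩
    have e : 1 - x ^ 2 ≠ 0 := by nlinarith
    have e1 : 1 + x ≠ 0 := by linarith
    have e2 : 1 - x ≠ 0 := by linarith
    have a1 := ((hasDerivAt_id x).const_add 1).log e1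
    have a2 := ((hasDerivAt_id x).const_sub 1).log e2
    have a3 := (hasDerivAt_id x).mul ((a1.sub a2).div_const 2)
    have a4 := (hasDerivAt_entropyDeficit (by linarith) hx1).const_mul 2
    refine (a3.sub a4).congr_deriv ?_
    have e3 : 1 - x ^ 2 = (1 - x) * (1 + x) := by ring
    simp only [id, Pi.sub_apply]
    rw [e3]
    field_simp
    ring
  have hm : MonotoneOn
      (fun x : ℝ => x * ((Real.log (1 + x) - Real.log (1 - x)) / 2) - 2 * entropyDeficit x)
      (Set.Ico 0 1) := by
    refine monotoneOn_of_deriv_nonneg (convex_Ico 0 1)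
      (fun x hx => (hd x hx).continuousAt.continuousWithinAt) ?_ ?_
    · intro x hx
      exact (hd x (interior_subset hx)).differentiableAt.differentiableWithinAt
    · intro x hx
      have hx' := interior_subset hx
      rw [(hd x hx').deriv]
      linarith [log_one_add_sub_log_one_sub_le hx'.1 hx'.2]
  have := hm ⟨le_rfl, one_pos⟩ ⟨h0, h1⟩ h0
  simp [entropyDeficit_zero] at this
  linarith

/-- The derivative of `D / u ^ 2` is `(u * D' - 2 * D) / u ^ 3`. Monotonicity is what lets a factor
`a` of the bias come out as `a ^ 2`. -/
theorem entropyDeficit_div_sq_monotoneOn :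
    MonotoneOn (fun u => entropyDeficit u / u ^ 2) (Set.Ioc 0 1) := by
  have hd : ∀ x ∈ Set.Ioo (0 : ℝ) 1, HasDerivAt (fun u => entropyDeficit u / u ^ 2)
      ((x * ((Real.log (1 + x) - Real.log (1 - x)) / 2) - 2 * entropyDeficit x) / x ^ 3) x := by
    rintro x ⟨hx0, hx1⟩
    refine ((hasDerivAt_entropyDeficit (by linarith) hx1).div ((hasDerivAt_id x).pow 2)
      (by simp [hx0.ne'])).congr_deriv ?_
    simp only [id, Pi.pow_apply]
    field_simp
    ring
  refine monotoneOn_of_deriv_nonneg (convex_Ioc 0 1) ?_ ?_ ?_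
  · refine continuous_entropyDeficit.continuousOn.div (by fun_prop) ?_
    intro x hx
    have := hx.1
    positivity
  · intro x hx
    rw [interior_Ioc] at hx
    exact (hd x hx).differentiableAt.differentiableWithinAt
  · intro x hx
    rw [interior_Ioc] at hx
    rw [(hd x hx).deriv]
    have := hx.1
    exact div_nonneg (by linarith [two_mul_entropyDeficit_le hx.1.le hx.2]) (by positivity)

theorem entropyDeficit_mul_le {u a : ℝ} (hu0 : 0 ≤ u) (hu1 : u ≤ 1) (ha : |a| ≤ 1) :
    entropyDeficit (u * a) ≤ a ^ 2 * entropyDeficit u := by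
  have key : ∀ b : ℝ, 0 ≤ b → b ≤ 1 → entropyDeficit (u * b) ≤ b ^ 2 * entropyDeficit u := by
    intro b hb0 hb1
    rcases hu0.eq_or_lt with rfl | hu
    · simp [entropyDeficit_zero]
    rcases hb0.eq_or_lt with rfl | hb
    · simp [entropyDeficit_zero]
    have := entropyDeficit_div_sq_monotoneOn (a := u * b) (b := u)
      ⟨by positivity, by nlinarith⟩ ⟨hu, hu1⟩ (by nlinarith)
    simp only at this
    rw [div_le_div_iff₀ (by positivity) (by positivity)] at this
    have h2 : 0 < u ^ 2 := by positivity
    nlinarith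
  rcases le_total 0 a with h0 | h0
  · exact key a h0 (abs_le.1 ha).2
  · have := key (-a) (by linarith) (by linarith [(abs_le.1 ha).1])
    rw [mul_neg, entropyDeficit_neg] at this
    simpa using this

/-- The binary entropy dominates, on passing through a binary symmetric channel, the parabola in the
bias `a` of the input that agrees with it at `a = 0` and `a = ±1`. -/
theorem one_sub_sq_mul_le_h {p a : ℝ} (hp : p ∈ Set.Icc (0 : ℝ) (1 / 2)) (ha : |a| ≤ 1) :
    1 - a ^ 2 * (1 - h p) ≤ h ((1 + (1 - 2 * p) * a) / 2) := by
  have hl : 0 < Real.log 2 := Real.log_pos one_lt_two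
  have := entropyDeficit_mul_le (u := 1 - 2 * p) (by linarith [hp.2]) (by linarith [hp.1]) ha
  unfold entropyDeficit at this
  rw [show (1 + (1 - 2 * p)) / 2 = 1 - p by ring, Real.binEntropy_one_sub] at this
  rw [h_eq_binEntropy, h_eq_binEntropy, le_div_iff₀ hl]
  have e : (1 - a ^ 2 * (1 - Real.binEntropy p / Real.log 2)) * Real.log 2 =
    Real.log 2 - a ^ 2 * (Real.log 2 - Real.binEntropy p) := by field_simp
  linarith

/-! ### Second moments under a single channel use. -/

theorem sq_div_add_sq_div {x y u v : ℝ} (hu : 0 < u) (hv : 0 < v) :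
    x ^ 2 / u + y ^ 2 / v =
      (x + y) ^ 2 / (u + v) + (x * v - y * u) ^ 2 / (u * v * (u + v)) := by
  field_simp
  ring

/-- Both sums of quotients exceed `(c + d) ^ 2 / (a + b)` by an explicit Cauchy–Schwarz defect.
Mixing through the BSC scales the numerator of the defect by `(1 - 2 * p) ^ 2` and can only enlarge
its denominator, while the erasure channel keeps exactly the fraction `(1 - 2 * p) ^ 2` of it. -/
theorem sq_div_add_sq_div_bsc_le {p a b c d : ℝ} (hp : p ∈ Set.Icc (0 : ℝ) (1 / 2))
    (hc : |c| ≤ a) (hd : |d| ≤ b) :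
    ((1 - p) * c + p * d) ^ 2 / ((1 - p) * a + p * b) +
        (p * c + (1 - p) * d) ^ 2 / (p * a + (1 - p) * b) ≤
      (1 - (1 - 2 * p) ^ 2) * ((c + d) ^ 2 / (a + b)) +
        (1 - 2 * p) ^ 2 * (c ^ 2 / a + d ^ 2 / b) := by
  obtain ⟨hp0, hp1⟩ := hp
  have hq : 0 < 1 - p := by linarith
  have hz : ∀ r x y : ℝ, (r * x) ^ 2 / (r * y) = r * (x ^ 2 / y) := by
    intro r x y
    rcases eq_or_ne r 0 with rfl | hr
    · simp
    rw [mul_pow, sq r, mul_assoc, mul_div_mul_left _ _ hr, mul_div_assoc]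
  -- Zero mass forces zero signed mass, so the quotient `0 / 0 = 0` is harmless.
  rcases (le_trans (abs_nonneg _) hc).eq_or_lt with ha | ha
  · subst ha
    obtain rfl : c = 0 := abs_nonpos_iff.1 hc
    simp only [mul_zero, zero_add, hz]
    simp only [ne_eq, OfNat.ofNat_ne_zero, not_false_eq_true, zero_pow, div_zero, zero_add]
    exact le_of_eq (by ring)
  rcases (le_trans (abs_nonneg _) hd).eq_or_lt with hb | hb
  · subst hb
    obtain rfl : d = 0 := abs_nonpos_iff.1 hd
    simp only [mul_zero, add_zero, hz]
    simp only [ne_eq, OfNat.ofNat_ne_zero, not_false_eq_true, zero_pow, div_zero, add_zero]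
    exact le_of_eq (by ring)
  have h1 : 0 < (1 - p) * a + p * b := by positivity
  have h2 : 0 < p * a + (1 - p) * b := by positivity
  rw [sq_div_add_sq_div h1 h2, sq_div_add_sq_div ha hb]
  have e1 : (1 - p) * c + p * d + (p * c + (1 - p) * d) = c + d := by ring
  have e2 : (1 - p) * a + p * b + (p * a + (1 - p) * b) = a + b := by ring
  have e3 : ((1 - p) * c + p * d) * (p * a + (1 - p) * b) -
    (p * c + (1 - p) * d) * ((1 - p) * a + p * b) = (1 - 2 * p) * (c * b - d * a) := by ring
  rw [e1, e2, e3]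
  -- The difference of the two sides is `p * (1 - p) * (a - b) ^ 2`.
  have h3 : a * b ≤ ((1 - p) * a + p * b) * (p * a + (1 - p) * b) := by
    nlinarith [mul_nonneg (mul_nonneg hp0 hq.le) (sq_nonneg (a - b))]
  have h4 : ((1 - 2 * p) * (c * b - d * a)) ^ 2 /
      (((1 - p) * a + p * b) * (p * a + (1 - p) * b) * (a + b)) ≤
      ((1 - 2 * p) * (c * b - d * a)) ^ 2 / (a * b * (a + b)) := by
    gcongr
  have h5 : ((1 - 2 * p) * (c * b - d * a)) ^ 2 / (a * b * (a + b)) =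
    (1 - 2 * p) ^ 2 * ((c * b - d * a) ^ 2 / (a * b * (a + b))) := by
    rw [mul_pow, mul_div_assoc]
  linarith

theorem add_sq_div_add_le {a b c d : ℝ} (hc : |c| ≤ a) (hd : |d| ≤ b) :
    (c + d) ^ 2 / (a + b) ≤ c ^ 2 / a + d ^ 2 / b := by
  rcases (le_trans (abs_nonneg _) hc).eq_or_lt with ha | ha
  · subst ha
    obtain rfl : c = 0 := abs_nonpos_iff.1 hc
    simp
  rcases (le_trans (abs_nonneg _) hd).eq_or_lt with hb | hb
  · subst hb
    obtain rfl : d = 0 := abs_nonpos_iff.1 hd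
    simp
  rw [sq_div_add_sq_div ha hb]
  have : 0 ≤ (c * b - d * a) ^ 2 / (a * b * (a + b)) := by positivity
  linarith

/-! ### Output laws of repeated channel uses. -/

section

variable {V β γ : Type} [Fintype V]

/-- The (unnormalized) distribution of the outputs of independent uses of the channel `W`, the inputs
being the bits `ℓ i v` of a source `v` with weights `A`. -/
def outputLaw {m : ℕ} (W : ZMod 2 → β → ℝ) (ℓ : Fin m → V → ZMod 2) (A : V → ℝ)
    (y : Fin m → β) : ℝ :=
  ∑ v, A v * ∏ i, W (ℓ i v) (y i)

/-- Leaving laws unnormalized pays off here: observing one output merely reweights the source, so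
induction on the number of uses stays inside the same family. -/
theorem outputLaw_cons {m : ℕ} (W : ZMod 2 → β → ℝ) (ℓ : Fin (m + 1) → V → ZMod 2) (A : V → ℝ)
    (b : β) (y : Fin m → β) : outputLaw W ℓ A (Fin.cons b y) =
      outputLaw W (fun i => ℓ i.succ) (fun v => A v * W (ℓ 0 v) b) y := by
  simp [outputLaw, Fin.prod_univ_succ, mul_assoc]

/-- The part of the output law that comes from the inputs `v` with `g v = x`. -/
def fiberLaw {m : ℕ} (W : ZMod 2 → β → ℝ) (ℓ : Fin m → V → ZMod 2) (g : V → ZMod 2) (A : V → ℝ)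
    (y : Fin m → β) (x : ZMod 2) : ℝ :=
  outputLaw W ℓ (fun v => if g v = x then A v else 0) y

/-- Reduces one further channel use, with the other outputs fixed, to a two-point input law. -/
theorem outputLaw_mul {m : ℕ} (W : ZMod 2 → β → ℝ) (ℓ : Fin m → V → ZMod 2) (g : V → ZMod 2)
    (A : V → ℝ) (w : ZMod 2 → ℝ) (y : Fin m → β) :
    outputLaw W ℓ (fun v => A v * w (g v)) y = ∑ x, fiberLaw W ℓ g A y x * w x := by
  simp only [fiberLaw, outputLaw, Finset.sum_mul]
  rw [Finset.sum_comm]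
  refine Finset.sum_congr rfl fun v _ => ?_
  simp [ite_mul, mul_right_comm]

theorem abs_outputLaw_le {m : ℕ} {W : ZMod 2 → β → ℝ} (hW : ∀ x b, 0 ≤ W x b)
    (ℓ : Fin m → V → ZMod 2) {A B : V → ℝ} (hAB : ∀ v, |B v| ≤ A v) (y : Fin m → β) :
    |outputLaw W ℓ B y| ≤ outputLaw W ℓ A y := by
  refine (Finset.abs_sum_le_sum_abs _ _).trans (Finset.sum_le_sum fun v _ => ?_)
  have : 0 ≤ ∏ i, W (ℓ i v) (y i) := Finset.prod_nonneg fun i _ => hW _ _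
  rw [abs_mul, abs_of_nonneg this]
  exact mul_le_mul_of_nonneg_right (hAB v) this

theorem abs_fiberLaw_le {m : ℕ} {W : ZMod 2 → β → ℝ} (hW : ∀ x b, 0 ≤ W x b)
    (ℓ : Fin m → V → ZMod 2) (g : V → ZMod 2) {A B : V → ℝ} (hAB : ∀ v, |B v| ≤ A v)
    (y : Fin m → β) (x : ZMod 2) : |fiberLaw W ℓ g B y x| ≤ fiberLaw W ℓ g A y x := by
  refine abs_outputLaw_le hW ℓ (fun v => ?_) y
  split_ifs
  · exact hAB v
  · simp

theorem fiberLaw_nonneg {m : ℕ} {W : ZMod 2 → β → ℝ} (hW : ∀ x b, 0 ≤ W x b)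
    (ℓ : Fin m → V → ZMod 2) (g : V → ZMod 2) {A : V → ℝ} (hA : ∀ v, 0 ≤ A v)
    (y : Fin m → β) (x : ZMod 2) : 0 ≤ fiberLaw W ℓ g A y x :=
  (abs_nonneg _).trans (abs_fiberLaw_le hW ℓ g (B := A) (fun v => (abs_of_nonneg (hA v)).le) y x)

/-- The sign `(-1)^x` of a bit. -/
def bitSign (x : ZMod 2) : ℝ := if x = 0 then 1 else -1

theorem abs_bitSign (x : ZMod 2) : |bitSign x| = 1 := by
  unfold bitSign
  split_ifs <;> simp

/-- The uniform distribution on `V`. -/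
def uniformLaw (V : Type) [Fintype V] : V → ℝ := fun _ => (Fintype.card V : ℝ)⁻¹

/-- The uniform distribution on `V`, signed by the bit `g`. -/
def signedLaw (g : V → ZMod 2) : V → ℝ := fun v => uniformLaw V v * bitSign (g v)

theorem uniformLaw_nonneg (v : V) : 0 ≤ uniformLaw V v := by
  unfold uniformLaw
  positivity

theorem sum_uniformLaw [Nonempty V] : ∑ v, uniformLaw V v = 1 := by
  simp [uniformLaw]

theorem abs_signedLaw_le (g : V → ZMod 2) (v : V) : |signedLaw g v| ≤ uniformLaw V v := by
  rw [signedLaw, abs_mul, abs_bitSign, mul_one, abs_of_nonneg (uniformLaw_nonneg v)]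

theorem fiberLaw_zero_add_one {m : ℕ} (W : ZMod 2 → β → ℝ) (ℓ : Fin m → V → ZMod 2)
    (g : V → ZMod 2) (A : V → ℝ) (y : Fin m → β) :
    fiberLaw W ℓ g A y 0 + fiberLaw W ℓ g A y 1 = outputLaw W ℓ A y := by
  have := outputLaw_mul W ℓ g A (fun _ => 1) y
  simp only [mul_one, sum_zmod_two] at this
  exact this.symm

theorem fiberLaw_zero_sub_one {m : ℕ} (W : ZMod 2 → β → ℝ) (ℓ : Fin m → V → ZMod 2)
    (g : V → ZMod 2) (y : Fin m → β) :
    fiberLaw W ℓ g (uniformLaw V) y 0 - fiberLaw W ℓ g (uniformLaw V) y 1 =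
      outputLaw W ℓ (signedLaw g) y := by
  have h10 : (1 : ZMod 2) ≠ 0 := by decide
  have := outputLaw_mul W ℓ g (uniformLaw V) bitSign y
  simp only [sum_zmod_two, bitSign, if_true, h10, if_false] at this
  rw [show signedLaw g = fun v => uniformLaw V v * if g v = 0 then 1 else -1 from rfl, this]
  ring

/-! ### Comparison of channels by second moments. -/

variable [Fintype β] [Fintype γ]

/-- The second moment of the density of the output law of `B` with respect to that of `A`. -/
def chiSq {m : ℕ} (W : ZMod 2 → β → ℝ) (ℓ : Fin m → V → ZMod 2) (A B : V → ℝ) : ℝ :=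
  ∑ y, outputLaw W ℓ B y ^ 2 / outputLaw W ℓ A y

theorem sum_fin_cons {m : ℕ} (f : (Fin (m + 1) → β) → ℝ) :
    ∑ y, f y = ∑ b, ∑ y : Fin m → β, f (Fin.cons b y) := by
  rw [← Fintype.sum_prod_type']
  exact (Fintype.sum_equiv (Fin.consEquiv fun _ => β) _ _ fun _ => rfl).symm

/-- `W` preserves less of any signed bit law, in the sense of second moments of densities,
than `W'` does. -/
def ChiSqLE (W : ZMod 2 → β → ℝ) (W' : ZMod 2 → γ → ℝ) : Prop :=
  ∀ A B : ZMod 2 → ℝ, (∀ x, |B x| ≤ A x) →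
    ∑ b, (∑ x, B x * W x b) ^ 2 / (∑ x, A x * W x b) ≤
      ∑ b, (∑ x, B x * W' x b) ^ 2 / (∑ x, A x * W' x b)

/-- Channels are exchanged one at a time. With the first output fixed, induction exchanges the later
channels; with the later outputs fixed, the single-use hypothesis exchanges the first. Quantifying
over all dominated pairs `A`, `B` is what both moves need. -/
theorem ChiSqLE.chiSq_le {W : ZMod 2 → β → ℝ} {W' : ZMod 2 → γ → ℝ} (h : ChiSqLE W W')
    (hW : ∀ x b, 0 ≤ W x b) (hW' : ∀ x b, 0 ≤ W' x b) :
    ∀ {m : ℕ} (ℓ : Fin m → V → ZMod 2) {A B : V → ℝ}, (∀ v, |B v| ≤ A v) →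
      chiSq W ℓ A B ≤ chiSq W' ℓ A B
  | 0, ℓ, A, B, _ => by simp [chiSq, outputLaw]
  | m + 1, ℓ, A, B, hAB => by
    have h1 : ∀ b, chiSq W (fun i => ℓ i.succ) (fun v => A v * W (ℓ 0 v) b)
        (fun v => B v * W (ℓ 0 v) b) ≤ chiSq W' (fun i => ℓ i.succ) (fun v => A v * W (ℓ 0 v) b)
        (fun v => B v * W (ℓ 0 v) b) := fun b => h.chiSq_le hW hW' _ fun v => by
      rw [abs_mul, abs_of_nonneg (hW _ _)]
      exact mul_le_mul_of_nonneg_right (hAB v) (hW _ _)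
    calc chiSq W ℓ A B = ∑ b, chiSq W (fun i => ℓ i.succ) (fun v => A v * W (ℓ 0 v) b)
          (fun v => B v * W (ℓ 0 v) b) := by
          simp only [chiSq, sum_fin_cons, outputLaw_cons]
      _ ≤ ∑ b, chiSq W' (fun i => ℓ i.succ) (fun v => A v * W (ℓ 0 v) b)
          (fun v => B v * W (ℓ 0 v) b) := Finset.sum_le_sum fun b _ => h1 b
      _ = ∑ y, ∑ b, (∑ x, fiberLaw W' (fun i => ℓ i.succ) (ℓ 0) B y x * W x b) ^ 2 /
          (∑ x, fiberLaw W' (fun i => ℓ i.succ) (ℓ 0) A y x * W x b) := by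
          rw [Finset.sum_comm]
          simp only [chiSq]
          refine Finset.sum_congr rfl fun b _ => Finset.sum_congr rfl fun y _ => ?_
          rw [← outputLaw_mul W' _ (ℓ 0) A (fun x => W x b),
            ← outputLaw_mul W' _ (ℓ 0) B (fun x => W x b)]
      _ ≤ ∑ y, ∑ b, (∑ x, fiberLaw W' (fun i => ℓ i.succ) (ℓ 0) B y x * W' x b) ^ 2 /
          (∑ x, fiberLaw W' (fun i => ℓ i.succ) (ℓ 0) A y x * W' x b) :=
          Finset.sum_le_sum fun y _ => h _ _ fun x => abs_fiberLaw_le hW' _ _ hAB y x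
      _ = chiSq W' ℓ A B := by
          rw [Finset.sum_comm]
          simp only [chiSq, sum_fin_cons, outputLaw_cons]
          refine Finset.sum_congr rfl fun b _ => Finset.sum_congr rfl fun y _ => ?_
          rw [← outputLaw_mul W' _ (ℓ 0) A (fun x => W' x b),
            ← outputLaw_mul W' _ (ℓ 0) B (fun x => W' x b)]

theorem bsc_nonneg {t : ℝ} (ht : t ∈ Set.Icc (0 : ℝ) 1) (x y : ZMod 2) : 0 ≤ bsc t x y := by
  obtain ⟨⟨hp0, hp1⟩, -⟩ := hInv_spec (y := 1 - t) ⟨by linarith [ht.2], by linarith [ht.1]⟩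
  unfold bsc
  split_ifs <;> linarith

theorem bec_nonneg {t : ℝ} (ht : t ∈ Set.Icc (0 : ℝ) 1) (x : ZMod 2) (y : Option (ZMod 2)) :
    0 ≤ bec t x y := by
  rcases y with _ | y
  · simp only [bec]; linarith [ht.2]
  · simp only [bec]
    split_ifs
    · exact ht.1
    · exact le_rfl

theorem sum_bsc (t : ℝ) (x : ZMod 2) : ∑ y, bsc t x y = 1 := by
  have h10 : (1 : ZMod 2) ≠ 0 := by decide
  have h01 : (0 : ZMod 2) ≠ 1 := by decide
  rw [sum_zmod_two]
  have hx : x = 0 ∨ x = 1 := by revert x; decide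
  rcases hx with rfl | rfl <;> simp [bsc]

theorem sum_bec (t : ℝ) (x : ZMod 2) : ∑ y, bec t x y = 1 := by
  simp [Fintype.sum_option, bec]

theorem sum_bec_chiSq (t : ℝ) (A B : ZMod 2 → ℝ) :
    ∑ b, (∑ x, B x * bec t x b) ^ 2 / (∑ x, A x * bec t x b) =
      (1 - t) * ((B 0 + B 1) ^ 2 / (A 0 + A 1)) + t * (B 0 ^ 2 / A 0 + B 1 ^ 2 / A 1) := by
  have h10 : (1 : ZMod 2) ≠ 0 := by decide
  have h01 : (0 : ZMod 2) ≠ 1 := by decide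
  have hz : ∀ x y r : ℝ, (x * r) ^ 2 / (y * r) = r * (x ^ 2 / y) := by
    intro x y r
    rcases eq_or_ne r 0 with rfl | hr
    · simp
    rw [mul_pow, sq r, ← mul_assoc, mul_div_mul_right _ _ hr]
    ring
  simp only [sum_zmod_two, Fintype.sum_option, bec, h10, h01, if_true, if_false, mul_zero,
    zero_add, add_zero, ← add_mul, hz]
  ring

theorem bsc_chiSqLE_bec {t : ℝ} (ht : t ∈ Set.Icc (0 : ℝ) 1) : ChiSqLE (bsc t) (bec (eta t)) := by
  intro A B hAB
  obtain ⟨hp, -⟩ := hInv_spec (y := 1 - t) ⟨by linarith [ht.2], by linarith [ht.1]⟩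
  have h10 : (1 : ZMod 2) ≠ 0 := by decide
  have h01 : (0 : ZMod 2) ≠ 1 := by decide
  rw [sum_bec_chiSq]
  simp only [sum_zmod_two, bsc, h10, h01, if_true, if_false, eta]
  have := sq_div_add_sq_div_bsc_le hp (hAB 0) (hAB 1)
  simp only [mul_comm (B _), mul_comm (A _)]
  exact this

theorem bec_chiSqLE_bec {s t : ℝ} (hst : s ≤ t) : ChiSqLE (bec s) (bec t) := by
  intro A B hAB
  rw [sum_bec_chiSq, sum_bec_chiSq]
  nlinarith [add_sq_div_add_le (hAB 0) (hAB 1)]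

/-- The sum, over the bits `ℓ i` of a uniform source, of the mean posterior variance of `(-1)^(ℓ i)`
given the outputs of the channel `W` for the later bits. -/
def posteriorVariance (W : ZMod 2 → β → ℝ) : {m : ℕ} → (Fin m → V → ZMod 2) → ℝ
  | 0, _ => 0
  | _ + 1, ℓ => posteriorVariance W (fun i => ℓ i.succ) +
      (1 - chiSq W (fun i => ℓ i.succ) (uniformLaw V) (signedLaw (ℓ 0)))

theorem ChiSqLE.posteriorVariance_le {W : ZMod 2 → β → ℝ} {W' : ZMod 2 → γ → ℝ}
    (h : ChiSqLE W W') (hW : ∀ x b, 0 ≤ W x b) (hW' : ∀ x b, 0 ≤ W' x b) :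
    ∀ {m : ℕ} (ℓ : Fin m → V → ZMod 2), posteriorVariance W' ℓ ≤ posteriorVariance W ℓ
  | 0, _ => le_rfl
  | m + 1, ℓ => by
    have h1 := h.posteriorVariance_le hW hW' (fun i => ℓ i.succ)
    have h2 := h.chiSq_le hW hW' (fun i => ℓ i.succ) (abs_signedLaw_le (ℓ 0))
    simp only [posteriorVariance]
    linarith

/-- The entropy, in bits, of a finitely supported law. -/
def entropy (N : β → ℝ) : ℝ := ∑ y, -(N y * Real.logb 2 (N y))

theorem sum_outputLaw {m : ℕ} {W : ZMod 2 → β → ℝ} (hW1 : ∀ x, ∑ b, W x b = 1)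
    (ℓ : Fin m → V → ZMod 2) (A : V → ℝ) : ∑ y, outputLaw W ℓ A y = ∑ v, A v := by
  simp only [outputLaw]
  rw [Finset.sum_comm]
  refine Finset.sum_congr rfl fun v _ => ?_
  rw [← Finset.mul_sum, ← Fintype.prod_sum fun i b => W (ℓ i v) b]
  simp [hW1]

theorem entropy_outputLaw_succ {m : ℕ} (W : ZMod 2 → β → ℝ) (ℓ : Fin (m + 1) → V → ZMod 2)
    (A : V → ℝ) : entropy (outputLaw W ℓ A) = ∑ y, entropy fun b =>
      ∑ x, fiberLaw W (fun i => ℓ i.succ) (ℓ 0) A y x * W x b := by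
  simp only [entropy, sum_fin_cons, outputLaw_cons]
  rw [Finset.sum_comm]
  refine Finset.sum_congr rfl fun y _ => Finset.sum_congr rfl fun b _ => ?_
  rw [← outputLaw_mul W _ (ℓ 0) A (fun x => W x b)]

end

/-! ### Chain rule for the output entropy. -/

section

variable {V β : Type} [Fintype V] [Fintype β]

theorem entropy_pair {x y : ℝ} (hx : 0 ≤ x) (hy : 0 ≤ y) :
    -(x * Real.logb 2 x) + -(y * Real.logb 2 y) =
      -((x + y) * Real.logb 2 (x + y)) + (x + y) * h (x / (x + y)) := by
  rcases hx.eq_or_lt with rfl | hx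
  · simp [h]
  rcases hy.eq_or_lt with rfl | hy
  · simp [h, div_self hx.ne']
  have hs : x + y ≠ 0 := by positivity
  rw [h, one_sub_div hs, add_sub_cancel_left, Real.logb_div hx.ne' hs, Real.logb_div hy.ne' hs]
  field_simp
  ring

/-- Grouping splits off the total mass `a 0 + a 1`; the parabola bound at bias `(a 0 - a 1) / (a 0 +
a 1)` treats the remaining conditional entropy. -/
theorem entropy_bsc_ge {t : ℝ} (ht : t ∈ Set.Icc (0 : ℝ) 1) {a : ZMod 2 → ℝ} (ha : ∀ x, 0 ≤ a x) :
    -((a 0 + a 1) * Real.logb 2 (a 0 + a 1)) + (a 0 + a 1) -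
        t * ((a 0 - a 1) ^ 2 / (a 0 + a 1)) ≤
      entropy fun b => ∑ x, a x * bsc t x b := by
  obtain ⟨hp, hpt⟩ := hInv_spec (y := 1 - t) ⟨by linarith [ht.2], by linarith [ht.1]⟩
  have h10 : (1 : ZMod 2) ≠ 0 := by decide
  have h01 : (0 : ZMod 2) ≠ 1 := by decide
  simp only [entropy, sum_zmod_two, bsc, h10, h01, if_true, if_false]
  generalize hInv (1 - t) = p at *
  have h0 := ha 0
  have h1 := ha 1
  generalize a 0 = u at *
  generalize a 1 = v at *
  obtain ⟨hp0, hp1⟩ := hp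
  have hq : 0 ≤ 1 - p := by linarith
  rw [entropy_pair (by positivity) (by positivity)]
  have e : u * (1 - p) + v * p + (u * p + v * (1 - p)) = u + v := by ring
  rw [e]
  rcases (add_nonneg h0 h1).eq_or_lt with hs | hs
  · simp [← hs]
  have hb : |(u - v) / (u + v)| ≤ 1 := by
    rw [abs_div, abs_of_pos hs, div_le_one hs, abs_le]
    constructor <;> linarith
  have := one_sub_sq_mul_le_h ⟨hp0, hp1⟩ hb
  have e2 : (1 + (1 - 2 * p) * ((u - v) / (u + v))) / 2 = (u * (1 - p) + v * p) / (u + v) := by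
    field_simp
    ring
  rw [hpt, e2] at this
  have h3 := mul_le_mul_of_nonneg_left this hs.le
  have e3 : (u + v) * (1 - ((u - v) / (u + v)) ^ 2 * (1 - (1 - t))) =
    (u + v) - t * ((u - v) ^ 2 / (u + v)) := by
    field_simp
    ring
  linarith

/-- The erasure pattern contributes `h t`, and an unerased bit contributes its own entropy, which
equals one minus the squared bias exactly when, as here, the bias is 0 or ±1. -/
theorem entropy_bec_eq {t : ℝ} (ht : t ∈ Set.Icc (0 : ℝ) 1) {a : ZMod 2 → ℝ} (ha : ∀ x, 0 ≤ a x)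
    (h : a 0 = a 1 ∨ a 0 = 0 ∨ a 1 = 0) :
    (entropy fun b => ∑ x, a x * bec t x b) =
      -((a 0 + a 1) * Real.logb 2 (a 0 + a 1)) + (a 0 + a 1) * BinaryChannels.h t +
        t * ((a 0 + a 1) - (a 0 - a 1) ^ 2 / (a 0 + a 1)) := by
  have h10 : (1 : ZMod 2) ≠ 0 := by decide
  have h01 : (0 : ZMod 2) ≠ 1 := by decide
  simp only [entropy, sum_zmod_two, Fintype.sum_option, bec, h10, h01, if_true, if_false, mul_zero,
    zero_add, add_zero]
  have h0 := ha 0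
  have h1 := ha 1
  generalize a 0 = u at *
  generalize a 1 = v at *
  obtain ⟨ht0, ht1⟩ := ht
  have hs0 : 0 ≤ 1 - t := by linarith
  have key : ∀ N : ℝ, 0 ≤ N → -(N * t * Real.logb 2 (N * t)) +
      -(N * (1 - t) * Real.logb 2 (N * (1 - t))) =
      -(N * Real.logb 2 N) + N * BinaryChannels.h t := by
    intro N hN
    rw [entropy_pair (by positivity) (by positivity), ← mul_add, add_sub_cancel, mul_one]
    rcases hN.eq_or_lt with rfl | hN
    · simp
    rw [mul_div_cancel_left₀ _ hN.ne']
  rw [← add_mul]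
  have hsq : ∀ N : ℝ, N ^ 2 / N = N := by
    intro N
    rcases eq_or_ne N 0 with rfl | hN
    · simp
    field_simp
  rcases h with rfl | rfl | rfl
  · have hk := key (u + u) (by positivity)
    have : u * t * Real.logb 2 ((u + u) * t) = u * t * (1 + Real.logb 2 (u * t)) := by
      rcases eq_or_ne (u * t) 0 with h2 | h2
      · simp [h2]
      rw [show (u + u) * t = 2 * (u * t) by ring, Real.logb_mul two_ne_zero h2,
        Real.logb_self_eq_one one_lt_two]
    have e : (u + u) * t * Real.logb 2 ((u + u) * t) = 2 * (u * t * Real.logb 2 ((u + u) * t)) := by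
      ring
    rw [e, this] at hk
    simp only [sub_self, ne_eq, OfNat.ofNat_ne_zero, not_false_eq_true, zero_pow, zero_div, sub_zero]
    linarith
  · have hk := key v h1
    simp only [zero_add, zero_sub, neg_sq, hsq, zero_mul, neg_zero, sub_self, mul_zero, add_zero]
    linarith
  · have hk := key u h0
    simp only [add_zero, sub_zero, hsq, zero_mul, neg_zero, sub_self, mul_zero]
    linarith

/-- Summing the one-step bound over the later outputs gives their entropy, plus 1, minus `t` times
the second moment of the posterior sign. Rewriting the last two as `(1 - t) + t * (1 - chiSq)` gives
the stated form. -/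
theorem entropy_outputLaw_bsc_ge [Nonempty V] {t : ℝ} (ht : t ∈ Set.Icc (0 : ℝ) 1) :
    ∀ {m : ℕ} (ℓ : Fin m → V → ZMod 2),
      m * (1 - t) + t * posteriorVariance (bsc t) ℓ ≤
        entropy (outputLaw (bsc t) ℓ (uniformLaw V))
  | 0, ℓ => by simp [posteriorVariance, entropy, outputLaw, sum_uniformLaw]
  | m + 1, ℓ => by
    have ih := entropy_outputLaw_bsc_ge ht (fun i => ℓ i.succ)
    have h1 := fun y : Fin m → ZMod 2 => entropy_bsc_ge ht
      (fiberLaw_nonneg (bsc_nonneg ht) (fun i => ℓ i.succ) (ℓ 0) uniformLaw_nonneg y)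
    have h2 := Finset.sum_le_sum fun y (_ : y ∈ Finset.univ) => h1 y
    rw [← entropy_outputLaw_succ] at h2
    simp only [fiberLaw_zero_add_one, fiberLaw_zero_sub_one, Finset.sum_sub_distrib,
      Finset.sum_add_distrib, ← Finset.mul_sum, sum_outputLaw (sum_bsc t), sum_uniformLaw] at h2
    simp only [posteriorVariance, chiSq]
    simp only [entropy] at ih h2 ⊢
    push_cast
    linarith

/-- Given the outputs of an erasure channel for some linear functionals of a uniform source, every
linear functional is either known or unbiased. -/
theorem fiberLaw_bec_eq [AddCommGroup V] {m : ℕ} (t : ℝ) (ℓ : Fin m → V →+ ZMod 2)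
    (g : V →+ ZMod 2) (y : Fin m → Option (ZMod 2)) :
    let F := fiberLaw (bec t) (fun i => ℓ i) g (uniformLaw V) y
    F 0 = F 1 ∨ F 0 = 0 ∨ F 1 = 0 := by
  intro F
  have h01 : ∀ z : ZMod 2, z = 0 ∨ z = 1 := by decide
  -- Translation by such a `w` is invisible at the unerased positions but flips `g`, so it matches
  -- the two fibers. Without one, two sources compatible with `y` cannot differ in `g`, since their
  -- difference would be such a `w`.
  by_cases hk : ∃ w, (∀ i, y i ≠ none → ℓ i w = 0) ∧ g w = 1
  · obtain ⟨w, hw, hgw⟩ := hk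
    left
    simp only [F, fiberLaw, outputLaw]
    refine Fintype.sum_equiv (Equiv.addRight w) _ _ fun v => ?_
    simp only [Equiv.coe_addRight, map_add, hgw]
    congr 1
    · have : g v + 1 = 1 ↔ g v = 0 := by simp
      simp only [this, uniformLaw]
    · refine Finset.prod_congr rfl fun i _ => ?_
      have hi := hw i
      cases hy : y i with
      | none => simp [bec]
      | some b => rw [hi (by simp [hy]), add_zero]
  · right
    by_contra! hF
    have ex : ∀ x, F x ≠ 0 → ∃ v, g v = x ∧ ∀ i, y i ≠ none → y i = some (ℓ i v) := by
      intro x hx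
      obtain ⟨v, -, hv⟩ := Finset.exists_ne_zero_of_sum_ne_zero hx
      refine ⟨v, ?_, fun i hi => ?_⟩
      · by_contra hg
        simp [hg] at hv
      · have hne := Finset.prod_ne_zero_iff.1 (right_ne_zero_of_mul hv) i (Finset.mem_univ i)
        cases hy : y i with
        | none => exact absurd hy hi
        | some b =>
          rw [hy] at hne
          simp only [bec] at hne
          by_contra hb
          exact hne (if_neg fun h => hb (by rw [h]))
    obtain ⟨v, hv, hv'⟩ := ex 0 hF.1
    obtain ⟨w, hw, hw'⟩ := ex 1 hF.2
    refine hk ⟨w - v, fun i hi => ?_, by simp [hv, hw]⟩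
    have := (hv' i hi).symm.trans (hw' i hi)
    rw [map_sub, Option.some.inj this, sub_self]

theorem entropy_outputLaw_bec_eq [AddCommGroup V] {t : ℝ} (ht : t ∈ Set.Icc (0 : ℝ) 1) :
    ∀ {m : ℕ} (ℓ : Fin m → V →+ ZMod 2),
      entropy (outputLaw (bec t) (fun i => ℓ i) (uniformLaw V)) =
        m * h t + t * posteriorVariance (bec t) (fun i => ⇑(ℓ i))
  | 0, ℓ => by simp [posteriorVariance, entropy, outputLaw, sum_uniformLaw]
  | m + 1, ℓ => by
    have ih := entropy_outputLaw_bec_eq ht (fun i => ℓ i.succ)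
    have h1 := fun y : Fin m → Option (ZMod 2) => entropy_bec_eq ht
      (fiberLaw_nonneg (bec_nonneg ht) (fun i => ℓ i.succ) (ℓ 0) uniformLaw_nonneg y)
      (fiberLaw_bec_eq t (fun i => ℓ i.succ) (ℓ 0) y)
    have h2 := Finset.sum_congr rfl fun y (_ : y ∈ Finset.univ) => h1 y
    rw [← entropy_outputLaw_succ (bec t) (fun i => ⇑(ℓ i))] at h2
    simp only [fiberLaw_zero_add_one, fiberLaw_zero_sub_one, Finset.sum_sub_distrib,
      Finset.sum_add_distrib, ← Finset.mul_sum, ← Finset.sum_mul, sum_outputLaw (sum_bec t),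
      sum_uniformLaw] at h2
    simp only [posteriorVariance, chiSq]
    simp only [entropy] at ih h2 ⊢
    push_cast
    linarith

/-! ### Mutual information of a uniform codeword. -/

theorem sum_prod_mul_logb_prod {c : ℝ} :
    ∀ {m : ℕ} (w : Fin m → β → ℝ), (∀ i, ∑ b, w i b = 1) →
      (∀ i, ∑ b, w i b * Real.logb 2 (w i b) = c) →
      ∑ y : Fin m → β, (∏ i, w i (y i)) * Real.logb 2 (∏ i, w i (y i)) = m * c
  | 0, w, _, _ => by simp
  | m + 1, w, h1, hc => by
    have ih := sum_prod_mul_logb_prod (fun i => w i.succ) (fun i => h1 _) (fun i => hc _)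
    have hm : ∀ x y : ℝ, x * y * Real.logb 2 (x * y) =
        x * Real.logb 2 x * y + x * (y * Real.logb 2 y) := by
      intro x y
      rcases eq_or_ne x 0 with rfl | hx
      · simp
      rcases eq_or_ne y 0 with rfl | hy
      · simp
      rw [Real.logb_mul hx hy]
      ring
    have hs : ∑ y : Fin m → β, ∏ i, w i.succ (y i) = 1 := by
      rw [← Fintype.prod_sum fun i b => w (Fin.succ i) b]
      simp [h1]
    rw [sum_fin_cons]
    simp only [Fin.prod_univ_succ, Fin.cons_zero, Fin.cons_succ, hm, Finset.sum_add_distrib,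
      ← Finset.mul_sum, hs, ih, ← Finset.sum_mul, h1, hc]
    push_cast
    ring

theorem sum_uniformOn_mul {n : ℕ} (C : Submodule (ZMod 2) (Fin n → ZMod 2)) [Fintype C]
    (f : (Fin n → ZMod 2) → ℝ) :
    ∑ x, uniformOn (C : Set (Fin n → ZMod 2)) x * f x = ∑ v : C, uniformLaw C v * f v := by
  classical
  have hc : (C : Set (Fin n → ZMod 2)).ncard = Fintype.card C := by
    rw [← Nat.card_coe_set_eq, Nat.card_eq_fintype_card]
    rfl
  simp only [uniformOn, uniformLaw, hc, Set.indicator_apply, ite_mul, zero_mul]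
  rw [← Finset.sum_filter]
  exact Finset.sum_subtype _ (by simp) _

/-- This is output entropy minus noise entropy; the latter is `-c` per use whatever the input. -/
theorem mutualInfo_uniformOn {n : ℕ} (C : Submodule (ZMod 2) (Fin n → ZMod 2)) [Fintype C]
    {W : ZMod 2 → β → ℝ} {c : ℝ} (hW : ∀ x b, 0 ≤ W x b) (hW1 : ∀ x, ∑ b, W x b = 1)
    (hc : ∀ x, ∑ b, W x b * Real.logb 2 (W x b) = c) :
    mutualInfo (joint (uniformOn (C : Set (Fin n → ZMod 2))) (memoryless n W)) =
      entropy (outputLaw W (fun i (v : C) => v.1 i) (uniformLaw C)) + n * c := by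
  have hP : ∀ x, 0 ≤ uniformOn (C : Set (Fin n → ZMod 2)) x := fun x =>
    Set.indicator_nonneg (fun _ _ => by positivity) x
  rw [mutualInfo_joint _ (memoryless n W) hP (fun x y => Finset.prod_nonneg fun i _ => hW _ _)]
  · simp only [sum_uniformOn_mul, memoryless]
    congr 1
    simp only [sum_prod_mul_logb_prod _ (fun _ => hW1 _) (fun _ => hc _)]
    rw [← Finset.sum_mul, sum_uniformLaw, one_mul]
  · intro x
    simp only [memoryless]
    rw [← Fintype.prod_sum fun i b => W (x i) b]
    simp [hW1]

theorem mul_posteriorVariance_le_infoBSC {n : ℕ} (C : Submodule (ZMod 2) (Fin n → ZMod 2))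
    [Fintype C] {t : ℝ} (ht : t ∈ Set.Icc (0 : ℝ) 1) :
    t * posteriorVariance (bsc t) (fun i (v : C) => v.1 i) ≤
      infoBSC t (uniformOn (C : Set (Fin n → ZMod 2))) := by
  have hc : ∀ x, ∑ b, bsc t x b * Real.logb 2 (bsc t x b) = -(1 - t) := by
    obtain ⟨-, hpt⟩ := hInv_spec (y := 1 - t) ⟨by linarith [ht.2], by linarith [ht.1]⟩
    intro x
    have hx : x = 0 ∨ x = 1 := by revert x; decide
    rw [← hpt, h]
    rcases hx with rfl | rfl
    · simp [sum_zmod_two, bsc]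
    · simp [sum_zmod_two, bsc]
      ring
  rw [infoBSC, mutualInfo_uniformOn C (bsc_nonneg ht) (sum_bsc t) hc]
  linarith [entropy_outputLaw_bsc_ge ht (fun i (v : C) => v.1 i)]

theorem sum_bec_mul_logb (t : ℝ) (x : ZMod 2) :
    ∑ b, bec t x b * Real.logb 2 (bec t x b) = -h t := by
  rw [h]
  have hx : x = 0 ∨ x = 1 := by revert x; decide
  rcases hx with rfl | rfl <;> simp [Fintype.sum_option, bec]

theorem infoBEC_eq {n : ℕ} (C : Submodule (ZMod 2) (Fin n → ZMod 2)) [Fintype C] {t : ℝ}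
    (ht : t ∈ Set.Icc (0 : ℝ) 1) : infoBEC t (uniformOn (C : Set (Fin n → ZMod 2))) =
      t * posteriorVariance (bec t) (fun i (v : C) => v.1 i) := by
  rw [infoBEC, mutualInfo_uniformOn C (bec_nonneg ht) (sum_bec t) (sum_bec_mul_logb t)]
  have := entropy_outputLaw_bec_eq ht fun i =>
    ((Pi.evalAddMonoidHom (fun _ => ZMod 2) i).comp C.toAddSubgroup.subtype : C →+ ZMod 2)
  have h2 : entropy (outputLaw (bec t) (fun i (v : C) => v.1 i) (uniformLaw C)) =
    n * h t + t * posteriorVariance (bec t) (fun i (v : C) => v.1 i) := this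
  linarith

/-- The erasure channel of capacity `1` is noiseless. -/
theorem infoBEC_one {n : ℕ} (C : Submodule (ZMod 2) (Fin n → ZMod 2)) [Fintype C] :
    infoBEC 1 (uniformOn (C : Set (Fin n → ZMod 2))) = Real.logb 2 (Fintype.card C) := by
  classical
  have h1 : (1 : ℝ) ∈ Set.Icc (0 : ℝ) 1 := by simp
  rw [infoBEC, mutualInfo_uniformOn C (bec_nonneg h1) (sum_bec 1) (sum_bec_mul_logb 1)]
  have hprod : ∀ (v : C) (y : Fin n → Option (ZMod 2)), ∏ i, bec 1 (v.1 i) (y i) =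
      if y = fun i => some (v.1 i) then 1 else 0 := by
    intro v y
    have hb : ∀ i, bec 1 (v.1 i) (y i) = if y i = some (v.1 i) then 1 else 0 := by
      intro i
      cases y i <;> simp [bec]
    simp only [hb, Finset.prod_ite_zero, funext_iff]
    simp
  have hout : ∀ v : C, outputLaw (bec 1) (fun i (v : C) => v.1 i) (uniformLaw C)
      (fun i => some (v.1 i)) = uniformLaw C v := by
    intro v
    simp only [outputLaw, hprod, mul_ite, mul_one, mul_zero]
    rw [Finset.sum_eq_single v]
    · simp
    · intro w _ hw
      refine if_neg fun h => hw (Subtype.ext (funext fun i => ?_))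
      exact (Option.some.inj (congrFun h i)).symm
    · simp
  have hsum : ∀ f : (Fin n → Option (ZMod 2)) → ℝ,
      ∑ y, outputLaw (bec 1) (fun i (v : C) => v.1 i) (uniformLaw C) y * f y =
        ∑ v : C, uniformLaw C v * f fun i => some (v.1 i) := by
    intro f
    simp only [outputLaw, hprod, Finset.sum_mul]
    rw [Finset.sum_comm]
    simp
  have h0 : h 1 = 0 := by simp [h]
  simp only [entropy, Finset.sum_neg_distrib]
  rw [hsum, h0]
  simp only [hout, ← Finset.sum_mul, uniformLaw, Real.logb_inv]
  simp

end

/-! ### The threshold at the rate, and the conclusion. -/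

theorem eta_mem_Icc {t : ℝ} (ht : t ∈ Set.Icc (0 : ℝ) 1) : eta t ∈ Set.Icc (0 : ℝ) 1 := by
  obtain ⟨⟨hp0, hp1⟩, -⟩ := hInv_spec (y := 1 - t) ⟨by linarith [ht.2], by linarith [ht.1]⟩
  exact ⟨sq_nonneg _, pow_le_one₀ (by linarith) (by linarith)⟩

theorem lt_one_sub_h_iff {t R : ℝ} (ht : t ∈ Set.Icc (0 : ℝ) 1) (hR : R ∈ Set.Icc (0 : ℝ) 1) :
    t < 1 - h ((1 - √R) / 2) ↔ eta t < R := by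
  obtain ⟨⟨hp0, hp1⟩, hp⟩ := hInv_spec (y := 1 - t) ⟨by linarith [ht.2], by linarith [ht.1]⟩
  have hs0 := Real.sqrt_nonneg R
  have hs1 : √R ≤ 1 := Real.sqrt_le_one.2 hR.2
  have h1 : t < 1 - h ((1 - √R) / 2) ↔ h ((1 - √R) / 2) < h (hInv (1 - t)) := by
    rw [hp]
    constructor <;> intro <;> linarith
  rw [h1, h_strictMonoOn.lt_iff_lt ⟨by linarith, by linarith⟩ ⟨hp0, hp1⟩, eta,
    ← Real.lt_sqrt (by linarith)]
  constructor <;> intro <;> linarith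

theorem rate_le_one {n : ℕ} (C : Set (Fin n → ZMod 2)) : rate C ≤ 1 := by
  refine div_le_one_of_le₀ ?_ (Nat.cast_nonneg n)
  rcases Nat.eq_zero_or_pos C.ncard with h0 | h0
  · simp [h0]
  have h1 : C.ncard ≤ 2 ^ n := by
    have := Set.ncard_le_ncard (Set.subset_univ C)
    simpa [Set.ncard_univ] using this
  calc Real.logb 2 C.ncard ≤ Real.logb 2 ((2 : ℝ) ^ n) :=
        Real.logb_le_logb_of_le one_lt_two (by exact_mod_cast h0) (by exact_mod_cast h1)
    _ = n := by rw [Real.logb_pow, Real.logb_self_eq_one one_lt_two, mul_one]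

theorem posteriorVariance_bec_antitoneOn {V : Type} [Fintype V] {m : ℕ}
    (ℓ : Fin m → V → ZMod 2) :
    AntitoneOn (fun s => posteriorVariance (bec s) ℓ) (Set.Icc 0 1) := fun _ hs _ ht hst =>
  (bec_chiSqLE_bec hst).posteriorVariance_le (bec_nonneg hs) (bec_nonneg ht) ℓ

/-- Below its rate, a capacity achieving linear code loses nothing to first order. -/
theorem IsInfoCapacityAchievingBEC.le_rate_mul_posteriorVariance {n : ℕ}
    {C : Submodule (ZMod 2) (Fin n → ZMod 2)} [Fintype C] {ε : ℝ} (hε : 0 ≤ ε)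
    (hC : IsInfoCapacityAchievingBEC (C : Set (Fin n → ZMod 2)) ε)
    (hR0 : 0 < rate (C : Set (Fin n → ZMod 2))) {s : ℝ} (hs0 : 0 ≤ s)
    (hs : s ≤ rate (C : Set (Fin n → ZMod 2))) :
    n * (rate (C : Set (Fin n → ZMod 2)) - ε) ≤ rate (C : Set (Fin n → ZMod 2)) *
      posteriorVariance (bec s) (fun i (v : C) => v.1 i) := by
  have hR1 := rate_le_one (C : Set (Fin n → ZMod 2))
  have hsI : s ∈ Set.Icc (0 : ℝ) 1 := ⟨hs0, hs.trans hR1⟩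
  -- At rate 1 no capacity lies above the rate and the hypothesis is void; the noiseless erasure
  -- channel then gives posterior variance `n` directly.
  rcases hR1.eq_or_lt with hR | hR
  · have h1 : (1 : ℝ) ∈ Set.Icc (0 : ℝ) 1 := by simp
    have h2 := infoBEC_one C
    rw [infoBEC_eq C h1, one_mul] at h2
    have h3 := posteriorVariance_bec_antitoneOn (fun i (v : C) => v.1 i) hsI h1 hsI.2
    have hc : (C : Set (Fin n → ZMod 2)).ncard = Fintype.card C := by
      rw [← Nat.card_coe_set_eq, Nat.card_eq_fintype_card]
      rfl
    have hn : (n : ℝ) ≠ 0 := by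
      rintro hn
      rw [rate, hn, div_zero] at hR0
      exact hR0.false
    have h4 : Real.logb 2 (Fintype.card C) = n := by
      rw [rate, hc, div_eq_one_iff_eq hn] at hR
      exact hR
    simp only [h2, h4] at h3
    rw [hR, one_mul]
    nlinarith [Nat.cast_nonneg (α := ℝ) n]
  -- The hypothesis covers only `r` above the rate, so the bound is proved with `r` in place of the
  -- rate and `r` tends to the rate from above, with `s` fixed.
  · have hlim : Filter.Tendsto
        (fun r : ℝ => r * posteriorVariance (bec s) (fun i (v : C) => v.1 i))
        (nhdsWithin (rate (C : Set (Fin n → ZMod 2))) (Set.Ioi (rate (C : Set (Fin n → ZMod 2)))))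
        (nhds (rate (C : Set (Fin n → ZMod 2)) *
          posteriorVariance (bec s) (fun i (v : C) => v.1 i))) :=
      (continuous_id.mul continuous_const).continuousAt.continuousWithinAt
    refine ge_of_tendsto hlim ?_
    filter_upwards [Ioc_mem_nhdsGT hR] with r hr
    have hrI : r ∈ Set.Icc (0 : ℝ) 1 := ⟨hR0.le.trans hr.1.le, hr.2⟩
    refine (hC r hr.1 hr.2).trans ?_
    rw [infoBEC_eq C hrI]
    exact mul_le_mul_of_nonneg_left
      (posteriorVariance_bec_antitoneOn _ hsI hrI (hs.trans hr.1.le)) hrI.1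

/-- Information lower bound on the binary symmetric channel for linear codes that achieve capacity
on the erasure channel. -/
theorem IsInfoCapacityAchievingBEC.infoBSC_ge {n : ℕ}
    (C : Submodule (ZMod 2) (Fin n → ZMod 2)) (R ε : ℝ)
    (hR : rate (C : Set (Fin n → ZMod 2)) = R) (hR0 : 0 < R) (hε : 0 ≤ ε)
    (hC : IsInfoCapacityAchievingBEC (C : Set (Fin n → ZMod 2)) ε)
    (t : ℝ) (ht : t ∈ Set.Icc (0 : ℝ) 1) :
    infoBSC t (uniformOn (C : Set (Fin n → ZMod 2))) ≥
      n * (1 - ε / R) *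
        (if t < 1 - h ((1 - √R) / 2) then t
          else t * R / eta t) := by
  have : Fintype C := Fintype.ofFinite C
  have hη := eta_mem_Icc ht
  have hR1 : R ≤ 1 := hR ▸ rate_le_one (C : Set (Fin n → ZMod 2))
  have hmain : t * posteriorVariance (bec (eta t)) (fun i (v : C) => v.1 i) ≤
      infoBSC t (uniformOn (C : Set (Fin n → ZMod 2))) :=
    (mul_le_mul_of_nonneg_left ((bsc_chiSqLE_bec ht).posteriorVariance_le (bsc_nonneg ht)
      (bec_nonneg hη) _) ht.1).trans (mul_posteriorVariance_le_infoBSC C ht)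
  refine le_trans ?_ hmain
  have hlow : eta t ≤ R → n * (1 - ε / R) ≤
      posteriorVariance (bec (eta t)) (fun i (v : C) => v.1 i) := by
    intro hle
    have := hC.le_rate_mul_posteriorVariance hε (hR ▸ hR0) hη.1 (hR ▸ hle)
    rw [hR, ← div_le_iff₀' hR0] at this
    refine le_trans (le_of_eq ?_) this
    field_simp
  rw [if_congr (lt_one_sub_h_iff ht ⟨hR0.le, hR1⟩) rfl rfl]
  split_ifs with hlt
  · rw [mul_comm]
    exact mul_le_mul_of_nonneg_left (hlow hlt.le) ht.1
  -- At `eta t = R` the strict hypothesis does not apply, but the limiting bound does and the two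
  -- formulas coincide.
  · rcases (not_lt.1 hlt).eq_or_lt with heq | hgt
    · rw [heq, mul_div_cancel_right₀ _ (heq ▸ hR0).ne', mul_comm, ← heq]
      exact mul_le_mul_of_nonneg_left (heq ▸ hlow heq.ge) ht.1
    · have hη0 : 0 < eta t := hR0.trans hgt
      have := hC (eta t) (hR ▸ hgt) hη.2
      rw [infoBEC_eq C hη, hR, ← div_le_iff₀' hη0] at this
      refine le_trans (le_of_eq ?_) (mul_le_mul_of_nonneg_left this ht.1)
      field_simp

end

end BinaryChannels

theorem theorem3 {n : ℕ} (C : Submodule (ZMod 2) (Fin n → ZMod 2)) (R ε : ℝ)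
    (hR : BinaryChannels.rate (C : Set (Fin n → ZMod 2)) = R) (hR0 : 0 < R) (hε : 0 ≤ ε)
    (hC : BinaryChannels.IsInfoCapacityAchievingBEC (C : Set (Fin n → ZMod 2)) ε)
    (t : ℝ) (ht : t ∈ Set.Icc (0 : ℝ) 1) :
    BinaryChannels.infoBSC t (BinaryChannels.uniformOn (C : Set (Fin n → ZMod 2))) ≥
      n * (1 - ε / R) *
        (if t < 1 - BinaryChannels.h ((1 - √R) / 2) then t
          else t * R / BinaryChannels.eta t) :=
  hC.infoBSC_ge C R ε hR hR0 hε t ht
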